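/- Let $d\ge 1$, and let $H=(V,E,m)$ be a finite weighted hypergraph with nonempty hyperedges $e_k$ of cardinality $|e_k|<d$ and weights $m_k\in\mathbb{Z}_{>0}$. Points of $\mathbb{P}^{d-1}(\mathbb{R})$ are written in the standard affine chart $\mathbb{R}^{d-1}$, and $\langle\cdot\rangle$ denotes the linear span in $\mathbb{R}^d$ of the corresponding vectors $(1,y)$. A pinned subspace-incidence system $(H,Q)$ assigns to every hyperedge $e_k$ a pinning subspace $q_k=\langle x^k_1,\dots,x^k_{m_k}\rangle$ of dimension $m_k$, given by pins $x^k_l\in\mathbb{R}^{d-1}$. A framework $(H,Q,p)$ realizing it is a map $p:V\to\mathbb{R}^{d-1}$ such that $q_k\subseteq\langle p(e_k)\rangle$ for all $k$. The framework $(H,Q,p)$ is *rigid* if $p$ has a neighborhood that contains no other realization of $(H,Q)$. For a pin $x^k_l$ let $E^k_l$ be the $|e_k|\times(d-1)$ matrix with rows $p(v)-x^k_l$, $v\in e_k$; the incidence constraints are $\det E^k_l[\,\cdot\,,C(t)]=0$ with $C(t)=\{1,\dots,|e_k|-1\}\cup\{|e_k|-1+t\}$ and $1\le t\le d-|e_k|$.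 The *rigidity matrix* of $(H,Q,p)$ is the Jacobian of these $\sum_k m_k(d-|e_k|)$ polynomials with respect to the $(d-1)|V|$ coordinates of $p$, and $(H,Q,p)$ is *infinitesimally rigid* if this matrix has rank $(d-1)|V|$. A framework $(H,Q,p)$ is generic with respect to a property $\mathcal{P}$ if $(Q,p)$, in the coordinates of pins and points, has a neighborhood in which every framework $(H,Q',p')$ satisfies $\mathcal{P}$ if and only if $(H,Q,p)$ does. It is called *generic* if it is generic with respect to both rigidity and infinitesimal rigidity. The system $(H,Q)$ is *generically rigid* if some generic framework realizing it is rigid. Then for every generic framework $(H,Q,p)$ the following are equivalent: (i) $(H,Q,p)$ is infinitesimally rigid; (ii) $(H,Q,p)$ is rigid; (iii) the system $(H,Q)$ is generically rigid. Moreover, the frameworks $(H,Q,p)$ on $H$ that are not generic form a null set in the space of frameworks, i.e. a set whose Hausdorff measure in dimension $(d-1)|V|+\sum_k m_k(|e_k|-1)$ is zero. -/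

import Mathlib

open Filter Topology MeasureTheory

/-- A finite weighted hypergraph `(V, E, m)` of rank `< d`, where `d = n + 1`. The hyperedges are
indexed by `E` and are nonempty subsets of `V`; the weights are positive integers. -/
structure WeightedHypergraph (V E : Type*) (n : ℕ) where
  edge : E → Finset V
  weight : E → ℕ
  edge_nonempty : ∀ k, (edge k).Nonempty
  rank_lt : ∀ k, (edge k).card < n + 1
  weight_pos : ∀ k, 0 < weight k

namespace WeightedHypergraph

variable {V E : Type*} {n : ℕ}

/-- The vector of `ℝ ^ (n + 1)` that represents the point of projective `n`-space with
coordinates `y ∈ ℝ ^ n` in the standard affine chart. -/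
def homog (y : Fin n → ℝ) : Fin (n + 1) → ℝ := Fin.cons 1 y

/-- A choice of `m_k` pins for each hyperedge `e_k`, in the affine chart. -/
abbrev Pins (H : WeightedHypergraph V E n) : Type _ := ∀ k : E, Fin (H.weight k) → Fin n → ℝ

/-- A realization of the vertices, in the affine chart. -/
abbrev Realization (_H : WeightedHypergraph V E n) : Type _ := V → Fin n → ℝ

/-- The pinning subspace `q_k` of `ℝ ^ (n + 1)`, spanned by the pins of `e_k`. -/
def pinningSubspace (H : WeightedHypergraph V E n) (x : H.Pins) (k : E) :
    Submodule ℝ (Fin (n + 1) → ℝ) :=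
  Submodule.span ℝ (Set.range fun l => homog (x k l))

/-- The pins of each hyperedge form a basis of the pinning subspace, so that `q_k` has
dimension `m_k`. -/
def IsSystem (H : WeightedHypergraph V E n) (x : H.Pins) : Prop :=
  ∀ k, LinearIndependent ℝ fun l => homog (x k l)

/-- `(H, Q, p)` is a framework: `(H, Q)` is a pinned subspace-incidence system and each pinning
subspace `q_k` is contained in the span of the points that realize the vertices of `e_k`. -/
def IsFramework (H : WeightedHypergraph V E n) (x : H.Pins) (p : H.Realization) : Prop :=
  H.IsSystem x ∧
    ∀ k, H.pinningSubspace x k ≤ Submodule.span ℝ ((fun v => homog (p v)) '' (H.edge k : Set V))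

/-- `(H, Q, p)` is rigid: some neighborhood of `p` has no other realization of `(H, Q)`. -/
def IsRigid (H : WeightedHypergraph V E n) (x : H.Pins) (p : H.Realization) : Prop :=
  ∃ N ∈ 𝓝 p, ∀ p' ∈ N, H.IsFramework x p' → p' = p

/-- The column set `C(t)`, in increasing order: the first `|e_k| - 1` coordinates and then the
`t`-th of the remaining ones (counted from zero). -/
def column (H : WeightedHypergraph V E n) (k : E) (t : Fin (n + 1 - (H.edge k).card))
    (i : Fin (H.edge k).card) : Fin n :=
  if (i : ℕ) + 1 < (H.edge k).card then ⟨i, by have := H.rank_lt k; omega⟩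
  else ⟨i + t, by have := H.rank_lt k; omega⟩

/-- The polynomial constraint `det (E^k_l[·, C(t)])`, where the rows of `E^k_l` are `p_v - x^k_l`
for the vertices `v` of `e_k` in increasing order. -/
def constraint [LinearOrder V] (H : WeightedHypergraph V E n) (x : H.Pins) (k : E)
    (l : Fin (H.weight k)) (t : Fin (n + 1 - (H.edge k).card)) (p : H.Realization) : ℝ :=
  Matrix.det (Matrix.of fun i j : Fin (H.edge k).card =>
    p ((H.edge k).orderEmbOfFin rfl i) (H.column k t j) - x k l (H.column k t j))

/-- The rows of the rigidity matrix: `m_k (d - |e_k|)` of them for each hyperedge `e_k`. -/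
abbrev Row (H : WeightedHypergraph V E n) : Type _ :=
  (k : E) × (Fin (H.weight k) × Fin (n + 1 - (H.edge k).card))

/-- The rigidity matrix: the Jacobian at `p` of the constraints, with respect to the coordinates of
the vertices. -/
noncomputable def rigidityMatrix [Fintype V] [LinearOrder V] (H : WeightedHypergraph V E n)
    (x : H.Pins) (p : H.Realization) : Matrix H.Row (V × Fin n) ℝ :=
  Matrix.of fun r c =>
    fderiv ℝ (H.constraint x r.1 r.2.1 r.2.2) p (Pi.single c.1 (Pi.single c.2 1))

/-- `(H, Q, p)` is infinitesimally rigid: the rigidity matrix has full rank `(d - 1) |V|`. -/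
def IsInfinitesimallyRigid [Fintype V] [LinearOrder V] (H : WeightedHypergraph V E n)
    (x : H.Pins) (p : H.Realization) : Prop :=
  (H.rigidityMatrix x p).rank = n * Fintype.card V

/-- The framework `(H, Q, p)` is generic with respect to the property `P`: all frameworks
`(H, Q', p')` in some neighborhood of it agree with it on `P`. -/
def IsGenericFor (H : WeightedHypergraph V E n) (P : H.Pins → H.Realization → Prop)
    (x : H.Pins) (p : H.Realization) : Prop :=
  ∃ N ∈ 𝓝 (x, p), ∀ z ∈ N, H.IsFramework z.1 z.2 → (P z.1 z.2 ↔ P x p)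

/-- A generic framework: generic with respect to rigidity and to infinitesimal rigidity. -/
def IsGenericFramework [Fintype V] [LinearOrder V] (H : WeightedHypergraph V E n)
    (x : H.Pins) (p : H.Realization) : Prop :=
  H.IsFramework x p ∧ H.IsGenericFor H.IsRigid x p ∧ H.IsGenericFor H.IsInfinitesimallyRigid x p

/-- The system `(H, Q)` is generically rigid: some generic framework realizing it is rigid. -/
def IsGenericallyRigid [Fintype V] [LinearOrder V] (H : WeightedHypergraph V E n)
    (x : H.Pins) : Prop :=
  ∃ p, H.IsGenericFramework x p ∧ H.IsRigid x p

/-- The dimension `(d - 1) |V| + ∑ m_k (|e_k| - 1)` of the space of frameworks. -/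
def frameworkDim [Fintype V] [Fintype E] (H : WeightedHypergraph V E n) : ℕ :=
  n * Fintype.card V + ∑ k, H.weight k * ((H.edge k).card - 1)

end WeightedHypergraph

open scoped ContDiff

/-! A pin lies in the projective span of the points of its hyperedge exactly when it is an affine
combination of them. Hence frameworks are the image of a polynomial map `param` on a Euclidean space
of dimension `frameworkDim`, whose parameters are the vertex coordinates and the affine coefficients
of the pins; linear independence of the pins is the only further condition. Realizing given pins
means finding a point in the fibre of `paramPins` over them, so rigidity asks whether that fibre is
locally a single point.

Call parameters regular if every hyperedge is nondegenerate in its first coordinates, so that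
`coparam` recovers the parameters from the framework, and if the derivative of `paramPins` has the
smallest possible kernel. This set is open, and its complement is null because it lies in zero sets
of nonzero analytic functions. At regular parameters whose pins form a system, infinitesimal
rigidity implies rigidity, as the derivative of the constraints is injective. Rigidity implies that
`paramPins` is immersive, since otherwise the constant rank theorem
(`frequently_eq_of_derivNullity_le`) gives other nearby points of the fibre. Immersivity implies
infinitesimal rigidity, since an infinitesimal motion lifts to a kernel vector of the derivative
(`derivNullity_paramPins_pos`).

So both properties are decided by the generic rank of `paramPins`, which depends on `H` alone.
Density of regular parameters carries this criterion to every generic framework, and a smooth image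
of the null complement contains all non-generic ones. -/

/-! ### Zero sets of real analytic functions -/

/-- The zero set of a real analytic function that is not identically zero is a null set. -/
theorem measure_zeros_eq_zero_of_contDiff_omega {E : Type*} [NormedAddCommGroup E]
    [NormedSpace ℝ E] [FiniteDimensional ℝ E] [MeasurableSpace E] [BorelSpace E]
    (μ : Measure E) [μ.IsAddHaarMeasure] {f : E → ℝ} (hf : ContDiff ℝ ω f) {a : E}
    (ha : f a ≠ 0) : μ {y | f y = 0} = 0 := by
  -- On each line through `a` the function is analytic and nonzero at `a`, so its zeros there are
  -- null. Fubini, read in the other order, then makes almost every rescaling about `a` of the zero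
  -- set null; one nonzero scale suffices.
  set S : Set (E × ℝ) := {z | f (a + z.2 • z.1) = 0}
  have hcont : Continuous fun z : E × ℝ => f (a + z.2 • z.1) := by
    have := hf.continuous
    fun_prop
  have hSm : MeasurableSet S := (isClosed_eq hcont continuous_const).measurableSet
  have hline : ∀ y : E, volume {t : ℝ | f (a + t • y) = 0} = 0 := by
    intro y
    have han : AnalyticOnNhd ℝ (fun t : ℝ => f (a + t • y)) Set.univ := by
      rw [← contDiff_omega_iff_analyticOnNhd]
      fun_prop
    rcases han.eqOn_zero_or_eventually_ne_zero_of_preconnected isPreconnected_univ with h | h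
    · exact absurd (by simpa using h (Set.mem_univ 0)) ha
    · have := ae_restrict_le_codiscreteWithin (μ := volume) MeasurableSet.univ h
      rw [Measure.restrict_univ] at this
      simpa [mem_ae_iff, Set.compl_ofPred] using this
  have hnull : (μ.prod volume) S = 0 :=
    Measure.measure_prod_null_of_ae_null hSm (ae_of_all _ fun y => hline y)
  have hnull' : ((volume : Measure ℝ).prod μ) (Prod.swap ⁻¹' S) = 0 := by
    rw [← Measure.prod_swap, Measure.map_apply measurable_swap hSm] at hnull
    exact hnull
  have hae := Measure.measure_ae_null_of_prod_null hnull'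
  have hne : ∀ᵐ t : ℝ, t ≠ 0 := by simp [ae_iff]
  obtain ⟨t, ht, ht0⟩ := (hae.and hne).exists
  have h1 : μ ((t • ·) ⁻¹' ((a + ·) ⁻¹' {y | f y = 0})) = 0 := ht
  rw [Measure.addHaar_preimage_smul μ ht0, measure_preimage_add, mul_eq_zero] at h1
  refine h1.resolve_left ?_
  simp [ht0]

/-! ### Null sets and Hausdorff measure -/

/-- A continuously differentiable map on `ℝ ^ ι` sends Lebesgue null sets to sets whose Hausdorff
measure in dimension `|ι|` vanishes. -/
theorem hausdorffMeasure_image_eq_zero_of_contDiff {ι X : Type*} [Fintype ι]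
    [NormedAddCommGroup X] [NormedSpace ℝ X] [MeasurableSpace X] [BorelSpace X]
    {f : (ι → ℝ) → X} (hf : ContDiff ℝ 1 f) {s : Set (ι → ℝ)} (hs : volume s = 0) :
    Measure.hausdorffMeasure (Fintype.card ι : ℝ) (f '' s) = 0 := by
  -- The map is locally Lipschitz, and countably many Lipschitz pieces cover the space; on `ι → ℝ`
  -- the Hausdorff measure of dimension `|ι|` is Lebesgue measure.
  have hloc : ∀ x : ι → ℝ, ∃ t ∈ 𝓝 x, ∃ K, LipschitzOnWith K f t := fun x => by
    obtain ⟨K, t, ht, h⟩ := hf.contDiffAt.exists_lipschitzOnWith (x := x)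
    exact ⟨t, ht, K, h⟩
  choose t ht K hK using hloc
  obtain ⟨c, hc, hcov⟩ := TopologicalSpace.countable_cover_nhds ht
  have hsub : f '' s ⊆ ⋃ x ∈ c, f '' (s ∩ t x) := by
    rintro _ ⟨y, hy, rfl⟩
    obtain ⟨x, hx, hyx⟩ := Set.mem_iUnion₂.1 (hcov.symm ▸ Set.mem_univ y)
    exact Set.mem_iUnion₂.2 ⟨x, hx, y, ⟨hy, hyx⟩, rfl⟩
  refine measure_mono_null hsub ((measure_biUnion_null_iff hc).2 fun x _ => ?_)
  refine le_antisymm ?_ bot_le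
  calc _ ≤ _ := ((hK x).mono Set.inter_subset_right).hausdorffMeasure_image_le (Nat.cast_nonneg _)
    _ = 0 := by
      rw [hausdorffMeasure_pi_real, measure_mono_null Set.inter_subset_left hs, mul_zero]

/-! ### Linear algebra -/

/-- Every linear map between vector spaces has a reflexive generalized inverse. -/
theorem LinearMap.exists_generalizedInverse {K E F : Type*} [Field K] [AddCommGroup E] [Module K E]
    [AddCommGroup F] [Module K F] (T : E →ₗ[K] F) :
    ∃ S : F →ₗ[K] E, (∀ v, T (S (T v)) = T v) ∧ ∀ y, S (T (S y)) = S y := by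
  -- `r` is a section of `T` over its range and `q` a projection onto that range.
  obtain ⟨r, hr⟩ := T.rangeRestrict.exists_rightInverse_of_surjective T.range_rangeRestrict
  obtain ⟨q, hq⟩ := T.range.subtype.exists_leftInverse_of_injective T.range.ker_subtype
  have hr' : ∀ y, T (r y) = y := fun y => congrArg Subtype.val (LinearMap.congr_fun hr y)
  have hq' : ∀ y : T.range, q y = y := fun y => LinearMap.congr_fun hq y
  refine ⟨r ∘ₗ q, fun v => ?_, fun y => ?_⟩
  · have h : q (T v) = T.rangeRestrict v := hq' (T.rangeRestrict v)
    simp [hr', h]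
  · simp [hr', hq']

/-- If `S` is a generalized inverse of `T₀` and `S T + (1 - S T₀)` is injective, then the kernel of
`S T` is at most as large as that of `T₀`. -/
theorem LinearMap.finrank_ker_comp_le {K E F : Type*} [Field K] [AddCommGroup E] [Module K E]
    [FiniteDimensional K E] [AddCommGroup F] [Module K F] {T T₀ : E →ₗ[K] F} {S : F →ₗ[K] E}
    (hS : ∀ v, T₀ (S (T₀ v)) = T₀ v)
    (hinj : ∀ v, S (T v) + (v - S (T₀ v)) = 0 → v = 0) :
    Module.finrank K (S ∘ₗ T).ker ≤ Module.finrank K T₀.ker := by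
  -- On the kernel of `S T` the injective map of the hypothesis reduces to `P`, which takes values
  -- in the kernel of `T₀`.
  let P : E →ₗ[K] E := LinearMap.id - S ∘ₗ T₀
  have hmaps : ∀ v ∈ (S ∘ₗ T).ker, P v ∈ T₀.ker := fun v _ => by simp [P, hS]
  refine LinearMap.finrank_le_finrank_of_injective (f := P.restrict hmaps) ?_
  rw [injective_iff_map_eq_zero]
  rintro ⟨v, hv⟩ h
  have h1 : v - S (T₀ v) = 0 := congrArg Subtype.val h
  have h2 : S (T v) = 0 := hv
  exact Subtype.ext (hinj v (by rw [h1, h2, add_zero]))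

/-! ### The rank of the derivative -/

theorem ContDiff.matrix_det {E κ : Type*} [NormedAddCommGroup E] [NormedSpace ℝ E] [Fintype κ]
    [DecidableEq κ] {N : WithTop ℕ∞} {A : E → Matrix κ κ ℝ}
    (hA : ∀ i j, ContDiff ℝ N fun w => A w i j) : ContDiff ℝ N fun w => (A w).det := by
  simp only [Matrix.det_apply]
  exact ContDiff.sum fun σ _ => (contDiff_prod fun i _ => hA _ _).const_smul _

/-- The dimension of the kernel of the derivative of `g` at `w`. -/
noncomputable def derivNullity {E F : Type*} [NormedAddCommGroup E] [NormedSpace ℝ E]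
    [NormedAddCommGroup F] [NormedSpace ℝ F] (g : E → F) (w : E) : ℕ :=
  Module.finrank ℝ (fderiv ℝ g w : E →ₗ[ℝ] F).ker

/-- The upper semicontinuity of the nullity of the derivative of an analytic map is witnessed by an
analytic function. -/
theorem exists_contDiff_omega_derivNullity_le {ι F : Type*} [Fintype ι] [NormedAddCommGroup F]
    [NormedSpace ℝ F] [FiniteDimensional ℝ F] {g : (ι → ℝ) → F} (hg : ContDiff ℝ ω g)
    (w₀ : ι → ℝ) :
    ∃ δ : (ι → ℝ) → ℝ, ContDiff ℝ ω δ ∧ δ w₀ ≠ 0 ∧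
      ∀ w, δ w ≠ 0 → derivNullity g w ≤ derivNullity g w₀ := by
  classical
  obtain ⟨S, hS, -⟩ := (fderiv ℝ g w₀ : (ι → ℝ) →ₗ[ℝ] F).exists_generalizedInverse
  -- The matrix is the identity at `w₀`; where its determinant is nonzero,
  -- `LinearMap.finrank_ker_comp_le` applies.
  let A : (ι → ℝ) → Matrix ι ι ℝ := fun w => LinearMap.toMatrix'
    (S ∘ₗ (fderiv ℝ g w : (ι → ℝ) →ₗ[ℝ] F)
      + (LinearMap.id - S ∘ₗ (fderiv ℝ g w₀ : (ι → ℝ) →ₗ[ℝ] F)))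
  have hfd : ContDiff ℝ ω (fderiv ℝ g) := hg.fderiv_right le_rfl
  have hA : ∀ i j, ContDiff ℝ ω fun w => A w i j := by
    intro i j
    have h1 : ContDiff ℝ ω fun w => S (fderiv ℝ g w (Pi.single j 1)) :=
      (LinearMap.toContinuousLinearMap S).contDiff.comp (hfd.clm_apply contDiff_const)
    have h2 : ContDiff ℝ ω fun w => S (fderiv ℝ g w (Pi.single j 1)) i := contDiff_pi.1 h1 i
    have : (fun w => A w i j) = fun w => S (fderiv ℝ g w (Pi.single j 1)) i +
        ((Pi.single j 1 : ι → ℝ) i - S (fderiv ℝ g w₀ (Pi.single j 1)) i) := by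
      funext w
      simp [A, LinearMap.toMatrix'_apply, Matrix.one_apply, Pi.single_apply]
    rw [this]
    exact h2.add contDiff_const
  refine ⟨fun w => (A w).det, ?_, ?_, fun w hw => ?_⟩
  · exact ContDiff.matrix_det hA
  · have : A w₀ = 1 := by simp [A]
    simp [this]
  · have hle : derivNullity g w ≤
        Module.finrank ℝ (S ∘ₗ (fderiv ℝ g w : (ι → ℝ) →ₗ[ℝ] F)).ker :=
      Submodule.finrank_mono (LinearMap.ker_le_ker_comp _ _)
    refine hle.trans (LinearMap.finrank_ker_comp_le hS fun v hv => ?_)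
    by_contra hne
    refine hw (Matrix.exists_mulVec_eq_zero_iff.1 ⟨v, hne, ?_⟩)
    rw [← Matrix.toLin'_apply, Matrix.toLin'_toMatrix']
    simpa using hv

/-- The set on which the derivative of an analytic map has maximal rank is open. -/
theorem isOpen_setOf_derivNullity_le {ι F : Type*} [Fintype ι] [NormedAddCommGroup F]
    [NormedSpace ℝ F] [FiniteDimensional ℝ F] {g : (ι → ℝ) → F} (hg : ContDiff ℝ ω g) :
    IsOpen {w | ∀ w', derivNullity g w ≤ derivNullity g w'} := by
  rw [isOpen_iff_mem_nhds]
  intro w hw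
  obtain ⟨δ, hδ, h0, hle⟩ := exists_contDiff_omega_derivNullity_le hg w
  filter_upwards [hδ.continuous.continuousAt.eventually_ne h0] with y hy w'
  exact (hle y hy).trans (hw w')

/-- The set on which the derivative of an analytic map does not have maximal rank is null. -/
theorem volume_setOf_not_derivNullity_le {ι F : Type*} [Fintype ι] [NormedAddCommGroup F]
    [NormedSpace ℝ F] [FiniteDimensional ℝ F] {g : (ι → ℝ) → F} (hg : ContDiff ℝ ω g) :
    volume {w | ¬ ∀ w', derivNullity g w ≤ derivNullity g w'} = 0 := by
  obtain ⟨w₀, hw₀⟩ : ∃ w₀, ∀ w', derivNullity g w₀ ≤ derivNullity g w' :=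
    ⟨Function.argmin (derivNullity g), fun w' => Function.argmin_le _ _⟩
  obtain ⟨δ, hδ, h0, hle⟩ := exists_contDiff_omega_derivNullity_le hg w₀
  refine measure_mono_null (fun w hw => ?_) (measure_zeros_eq_zero_of_contDiff_omega volume hδ h0)
  by_contra h
  exact hw fun w' => (hle w h).trans (hw₀ w')

/-- A map whose derivative has locally maximal, but not full, rank at a point is not injective near
that point. -/
theorem frequently_eq_of_derivNullity_le {E F : Type*} [NormedAddCommGroup E] [NormedSpace ℝ E]
    [FiniteDimensional ℝ E] [NormedAddCommGroup F] [NormedSpace ℝ F] [FiniteDimensional ℝ F]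
    {g : E → F} (hg : ContDiff ℝ 1 g) {w₀ : E} (hpos : 0 < derivNullity g w₀)
    (hmin : ∀ᶠ w in 𝓝 w₀, derivNullity g w₀ ≤ derivNullity g w) :
    ∃ᶠ w in 𝓝[≠] w₀, g w = g w₀ := by
  have : CompleteSpace E := FiniteDimensional.complete ℝ E
  set T : E → E →L[ℝ] F := fderiv ℝ g
  obtain ⟨S₀, hS₀, hS₀'⟩ := (T w₀ : E →ₗ[ℝ] F).exists_generalizedInverse
  let S : F →L[ℝ] E := LinearMap.toContinuousLinearMap S₀
  have hS : ∀ v, T w₀ (S (T w₀ v)) = T w₀ v := hS₀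
  have hS' : ∀ y, S (T w₀ (S y)) = S y := hS₀'
  -- A straightening chart: its derivative at `w₀` is the identity, and in it `g` will be constant
  -- along the kernel of `T w₀`.
  let h : E → E := fun w => S (g w) + (w - S (T w₀ w))
  have hgd : ∀ w, HasFDerivAt g (T w) w := fun w =>
    (hg.differentiable one_ne_zero w).hasFDerivAt
  have hh : ContDiff ℝ 1 h := by
    have h1 := S.contDiff.comp hg
    have h2 := S.contDiff.comp (T w₀).contDiff (n := 1)
    exact h1.add (contDiff_id.sub h2)
  have hhd : ∀ w, HasFDerivAt h (S ∘L T w + (ContinuousLinearMap.id ℝ E - S ∘L T w₀)) w :=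
    fun w => (S.hasFDerivAt.comp w (hgd w)).add
      ((hasFDerivAt_id w).sub (S.hasFDerivAt.comp w (T w₀).hasFDerivAt))
  have hhd₀ : HasFDerivAt h ((ContinuousLinearEquiv.refl ℝ E : E ≃L[ℝ] E) : E →L[ℝ] E) w₀ := by
    convert hhd w₀ using 1
    ext v
    simp
  set ψ : E → E := hh.contDiffAt.localInverse hhd₀ one_ne_zero
  have hψ0 : ψ (h w₀) = w₀ := hh.contDiffAt.localInverse_apply_image hhd₀ one_ne_zero
  have hψ : ContDiffAt ℝ 1 ψ (h w₀) := hh.contDiffAt.to_localInverse hhd₀ one_ne_zero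
  have hψr : ∀ᶠ y in 𝓝 (h w₀), h (ψ y) = y :=
    (hh.contDiffAt.hasStrictFDerivAt' hhd₀ one_ne_zero).eventually_right_inverse
  have hψt : Tendsto ψ (𝓝 (h w₀)) (𝓝 w₀) := by
    have := hψ.continuousAt.tendsto
    rwa [hψ0] at this
  have key : ∀ᶠ y in 𝓝 (h w₀), h (ψ y) = y ∧ DifferentiableAt ℝ ψ y ∧
      ∀ k, T w₀ k = 0 → T (ψ y) (fderiv ℝ ψ y k) = 0 := by
    filter_upwards [hψr, hψr.eventually_nhds, hψ.eventually (by simp), hψt.eventually hmin]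
      with y hy hy' hdiff hnull
    have hd : DifferentiableAt ℝ ψ y := hdiff.differentiableAt one_ne_zero
    refine ⟨hy, hd, fun k hk => ?_⟩
    have hcomp : HasFDerivAt (fun z => h (ψ z)) (ContinuousLinearMap.id ℝ E) y :=
      (hasFDerivAt_id y).congr_of_eventuallyEq hy'
    have heq := ((hhd (ψ y)).comp y hd.hasFDerivAt).unique hcomp
    have happ : ∀ v, S (T (ψ y) (fderiv ℝ ψ y v)) +
        (fderiv ℝ ψ y v - S (T w₀ (fderiv ℝ ψ y v))) = v := fun v => by
      simpa using congrArg (fun A : E →L[ℝ] E => A v) heq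
    -- Applying `S T₀` to `happ k`, with `T₀ = T w₀`, leaves only this term, because `S T₀ S = S`
    -- and `S T₀ k = 0`. Minimality of the nullity then makes the kernels of `T (ψ y)` and `S T (ψ
    -- y)` equal, so `S` can be dropped.
    have hST : S (T (ψ y) (fderiv ℝ ψ y k)) = 0 := by
      have h1 := congrArg (fun z => S (T w₀ z)) (happ k)
      simpa [hS, hS', hk] using h1
    have hsurj : Function.Surjective
        (S ∘L T (ψ y) + (ContinuousLinearMap.id ℝ E - S ∘L T w₀) : E →L[ℝ] E) := fun v =>
      ⟨fderiv ℝ ψ y v, by simpa using happ v⟩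
    have hinj := (LinearMap.injective_iff_surjective (f := ((S ∘L T (ψ y) +
      (ContinuousLinearMap.id ℝ E - S ∘L T w₀) : E →L[ℝ] E) : E →ₗ[ℝ] E))).2 hsurj
    have hle : Module.finrank ℝ (S₀ ∘ₗ (T (ψ y) : E →ₗ[ℝ] F)).ker ≤ derivNullity g w₀ :=
      LinearMap.finrank_ker_comp_le hS₀ fun v hv => hinj (by simpa [S] using hv)
    have hker : (T (ψ y) : E →ₗ[ℝ] F).ker = (S₀ ∘ₗ (T (ψ y) : E →ₗ[ℝ] F)).ker :=
      Submodule.eq_of_le_of_finrank_le (LinearMap.ker_le_ker_comp _ _) (hle.trans hnull)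
    have hmem : fderiv ℝ ψ y k ∈ (S₀ ∘ₗ (T (ψ y) : E →ₗ[ℝ] F)).ker := hST
    rw [← hker] at hmem
    exact hmem
  obtain ⟨k, hk, hk0⟩ : ∃ k, T w₀ k = 0 ∧ k ≠ 0 := by
    have : Nontrivial (T w₀ : E →ₗ[ℝ] F).ker := Module.finrank_pos_iff.1 hpos
    obtain ⟨⟨k, hk⟩, hne⟩ := exists_ne (0 : (T w₀ : E →ₗ[ℝ] F).ker)
    exact ⟨k, hk, fun h0 => hne (Subtype.ext h0)⟩
  obtain ⟨r, hr, hball⟩ := Metric.eventually_nhds_iff_ball.1 key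
  -- The curve `ψ ∘ c` passes through `w₀`, stays in the fibre of `g`, and leaves `w₀` for `t ≠ 0`
  -- because `h ∘ ψ` is the identity.
  let c : ℝ → E := fun t => h w₀ + t • k
  have hc : Continuous c := by fun_prop
  have hc0 : c 0 = h w₀ := by simp [c]
  let U : Set ℝ := c ⁻¹' Metric.ball (h w₀) r
  have hUo : IsOpen U := Metric.isOpen_ball.preimage hc
  have h0U : (0 : ℝ) ∈ U := by simp [U, hc0, hr]
  have hUc : IsPreconnected U := by
    have hU : U = AffineMap.lineMap (k := ℝ) (h w₀) (h w₀ + k) ⁻¹' Metric.ball (h w₀) r := by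
      ext t
      simp [U, c, AffineMap.lineMap_apply, add_comm]
    have : Convex ℝ U := hU ▸ (convex_ball (h w₀) r).affine_preimage _
    exact this.isPreconnected
  have hder : ∀ t ∈ U, HasDerivAt (fun t => g (ψ (c t))) 0 t := by
    intro t ht
    obtain ⟨-, hd, hz⟩ := hball _ ht
    have hcd : HasDerivAt c k t := by
      simpa [c] using ((hasDerivAt_id t).smul_const k).const_add (h w₀)
    have := (hgd (ψ (c t))).comp_hasDerivAt t (hd.hasFDerivAt.comp_hasDerivAt t hcd)
    rwa [hz k hk] at this
  have hconst : ∀ t ∈ U, g (ψ (c t)) = g w₀ := by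
    intro t ht
    have := hUo.is_const_of_deriv_eq_zero hUc
      (fun t ht => (hder t ht).differentiableAt.differentiableWithinAt)
      (fun t ht => (hder t ht).deriv) ht h0U
    rwa [hc0, hψ0] at this
  have htend : Tendsto (fun t => ψ (c t)) (𝓝[≠] 0) (𝓝[≠] w₀) := by
    rw [tendsto_nhdsWithin_iff]
    refine ⟨?_, ?_⟩
    · have h1 : Tendsto c (𝓝 0) (𝓝 (h w₀)) := hc0 ▸ hc.tendsto 0
      exact (hψt.comp h1).mono_left nhdsWithin_le_nhds
    · filter_upwards [self_mem_nhdsWithin, nhdsWithin_le_nhds (hUo.mem_nhds h0U)] with t ht htU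
      intro heq
      have h1 := (hball _ htU).1
      rw [Set.mem_singleton_iff] at heq
      rw [heq] at h1
      have : t • k = 0 := by simpa [c] using h1
      exact (smul_eq_zero.1 this).elim ht hk0
  refine htend.frequently (Eventually.frequently ?_)
  filter_upwards [nhdsWithin_le_nhds (hUo.mem_nhds h0U)] with t ht using hconst t ht

/-! ### Affine combinations with a distinguished last point -/

/-- The index `i`, as one of the first `m - 1` elements of `Fin m`. -/
def spokeIndex {m : ℕ} (i : Fin (m - 1)) : Fin m := ⟨i, by omega⟩

/-- The last element of `Fin m`. -/
def lastIndex {m : ℕ} (hm : 0 < m) : Fin m := ⟨m - 1, by omega⟩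

theorem spokeIndex_injective {m : ℕ} : Function.Injective (spokeIndex : Fin (m - 1) → Fin m) :=
  fun _ _ h => Fin.ext (Fin.mk.inj h)

theorem spokeIndex_ne_lastIndex {m : ℕ} (hm : 0 < m) (i : Fin (m - 1)) :
    spokeIndex i ≠ lastIndex hm := fun h => by
  have := congrArg Fin.val h
  simp only [spokeIndex, lastIndex] at this
  omega

theorem eq_lastIndex_or_spokeIndex {m : ℕ} (hm : 0 < m) (i : Fin m) :
    i = lastIndex hm ∨ ∃ j, i = spokeIndex j := by
  by_cases h : (i : ℕ) < m - 1
  · exact Or.inr ⟨⟨i, h⟩, rfl⟩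
  · exact Or.inl (Fin.ext (by simp only [lastIndex]; omega))

theorem sum_eq_sum_spokeIndex_add {m : ℕ} (hm : 0 < m) {M : Type*} [AddCommMonoid M]
    (f : Fin m → M) : ∑ i, f i = ∑ i, f (spokeIndex i) + f (lastIndex hm) := by
  obtain ⟨s, rfl⟩ : ∃ s, m = s + 1 := ⟨m - 1, by omega⟩
  exact Fin.sum_univ_castSucc f

/-- The affine combination of the points `P i` in which all points but the last have the
coefficients `a`. -/
def affinePoint {m n : ℕ} (hm : 0 < m) (P : Fin m → Fin n → ℝ) (a : Fin (m - 1) → ℝ) :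
    Fin n → ℝ := fun j =>
  P (lastIndex hm) j + ∑ i, a i * (P (spokeIndex i) j - P (lastIndex hm) j)

/-- The coefficients of all points in the affine combination `affinePoint`. -/
def affineCoeff {m : ℕ} (a : Fin (m - 1) → ℝ) (i : Fin m) : ℝ :=
  if h : (i : ℕ) < m - 1 then a ⟨i, h⟩ else 1 - ∑ i, a i

theorem affineCoeff_spokeIndex {m : ℕ} (a : Fin (m - 1) → ℝ) (i : Fin (m - 1)) :
    affineCoeff a (spokeIndex i) = a i := by
  simp [affineCoeff, spokeIndex]

theorem affineCoeff_lastIndex {m : ℕ} (hm : 0 < m) (a : Fin (m - 1) → ℝ) :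
    affineCoeff a (lastIndex hm) = 1 - ∑ i, a i := by
  simp [affineCoeff, lastIndex]

theorem sum_affineCoeff {m : ℕ} (hm : 0 < m) (a : Fin (m - 1) → ℝ) :
    ∑ i, affineCoeff a i = 1 := by
  simp [sum_eq_sum_spokeIndex_add hm, affineCoeff_spokeIndex, affineCoeff_lastIndex]

theorem exists_affineCoeff_ne_zero {m : ℕ} (hm : 0 < m) (a : Fin (m - 1) → ℝ) :
    ∃ i : Fin m, affineCoeff a i ≠ 0 := by
  by_contra! h
  simpa [h] using sum_affineCoeff hm a

theorem affinePoint_apply {m n : ℕ} (hm : 0 < m) (P : Fin m → Fin n → ℝ) (a : Fin (m - 1) → ℝ)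
    (j : Fin n) : affinePoint hm P a j = ∑ i, affineCoeff a i * P i j := by
  simp only [affinePoint, sum_eq_sum_spokeIndex_add hm (fun i => affineCoeff a i * P i j),
    affineCoeff_spokeIndex, affineCoeff_lastIndex, mul_sub, Finset.sum_sub_distrib,
    ← Finset.sum_mul]
  ring

theorem sum_affineCoeff_mul_sub {m n : ℕ} (hm : 0 < m) (P : Fin m → Fin n → ℝ)
    (a : Fin (m - 1) → ℝ) (j : Fin n) :
    ∑ i, affineCoeff a i * (P i j - affinePoint hm P a j) = 0 := by
  simp only [mul_sub, Finset.sum_sub_distrib, ← Finset.sum_mul, sum_affineCoeff hm,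
    affinePoint_apply, one_mul, sub_self]

/-- A point lies in the projective span of the points `P i` if and only if it is an affine
combination of them. -/
theorem homog_mem_span_iff {m n : ℕ} (hm : 0 < m) (P : Fin m → Fin n → ℝ) (x : Fin n → ℝ) :
    WeightedHypergraph.homog x ∈
        Submodule.span ℝ (Set.range fun i => WeightedHypergraph.homog (P i)) ↔
      ∃ a, x = affinePoint hm P a := by
  rw [Submodule.mem_span_range_iff_exists_fun]
  constructor
  · rintro ⟨c, hc⟩
    -- The homogenizing coordinate turns a linear combination into an affine one.
    have h0 : ∑ i, c i = 1 := by
      simpa [WeightedHypergraph.homog] using congrFun hc 0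
    have hj : ∀ j, ∑ i, c i * P i j = x j := fun j => by
      simpa [WeightedHypergraph.homog] using congrFun hc j.succ
    refine ⟨fun i => c (spokeIndex i), funext fun j => ?_⟩
    rw [sum_eq_sum_spokeIndex_add hm] at h0
    rw [← hj, sum_eq_sum_spokeIndex_add hm, affinePoint]
    simp only [mul_sub, Finset.sum_sub_distrib, ← Finset.sum_mul]
    rw [eq_sub_of_add_eq h0]
    ring
  · rintro ⟨a, rfl⟩
    refine ⟨affineCoeff a, funext fun j => ?_⟩
    refine Fin.cases ?_ (fun j => ?_) j
    · simpa [WeightedHypergraph.homog] using sum_affineCoeff hm a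
    · simp [WeightedHypergraph.homog, affinePoint_apply]

/-- The affine coefficients sum to 1, so they form a nonzero left kernel vector of the matrix. -/
theorem det_sub_affinePoint {m n : ℕ} (hm : 0 < m) (P : Fin m → Fin n → ℝ)
    (a : Fin (m - 1) → ℝ) (col : Fin m → Fin n) :
    (Matrix.of fun i j => P i (col j) - affinePoint hm P a (col j)).det = 0 := by
  obtain ⟨u, hu⟩ := exists_affineCoeff_ne_zero hm a
  refine Matrix.exists_vecMul_eq_zero_iff.1 ⟨affineCoeff a, fun h => hu (congrFun h u), ?_⟩
  funext j
  exact sum_affineCoeff_mul_sub hm P a (col j)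

/-! ### Derivatives of determinants -/

/-- The derivative of the determinant at a matrix `M` with left kernel vector `c`. -/
theorem hasDerivAt_det_of_vecMul_eq_zero {κ : Type*} [Fintype κ] [DecidableEq κ]
    (M M' : Matrix κ κ ℝ) {c : κ → ℝ} (hc : Matrix.vecMul c M = 0) (u : κ) :
    HasDerivAt (fun r : ℝ => c u * (M + r • M').det)
      (M.updateRow u (Matrix.vecMul c M')).det 0 := by
  -- Replacing row `u` by the `c`-combination of all rows multiplies the determinant by `c u`; since
  -- `c` kills `M`, that row carries a factor `r`.
  have heq : ∀ r : ℝ, c u * (M + r • M').det =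
      r * ((M + r • M').updateRow u (Matrix.vecMul c M')).det := by
    intro r
    have hrow : ∑ k, c k • (M + r • M') k = r • Matrix.vecMul c M' := by
      have : ∑ k, c k • (M + r • M') k = Matrix.vecMul c (M + r • M') := by
        funext j
        simp [Matrix.vecMul, dotProduct]
      rw [this, Matrix.vecMul_add, hc, zero_add, Matrix.vecMul_smul]
    rw [← smul_eq_mul, ← Matrix.det_updateRow_sum, hrow, Matrix.det_updateRow_smul]
  simp only [heq]
  have hd : ContDiff ℝ 1 fun r : ℝ => ((M + r • M').updateRow u (Matrix.vecMul c M')).det := by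
    refine ContDiff.matrix_det fun i j => ?_
    by_cases h : i = u
    · subst h
      simp only [Matrix.updateRow_self]
      exact contDiff_const
    · simp only [Matrix.updateRow_ne h, Matrix.add_apply, Matrix.smul_apply, smul_eq_mul]
      fun_prop
  have := (hasDerivAt_id' (0 : ℝ)).fun_mul ((hd.differentiable one_ne_zero) 0).hasDerivAt
  simpa only [one_mul, zero_mul, add_zero, zero_smul] using this

/-- If the determinants that test whether the affine combination of the points `P i` lies in
their span have vanishing derivative in the direction `P'`, then the induced velocity of the
combination is tangent to the span in the last of the selected coordinates as soon as it is so in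
the others. -/
theorem sum_mul_sub_eq_affinePoint_of_hasDerivAt_det {m n : ℕ} (hm : 0 < m)
    {P P' : Fin m → Fin n → ℝ} {a b : Fin (m - 1) → ℝ} {col : Fin m → Fin n}
    (hB : (Matrix.of fun i j : Fin (m - 1) =>
      P (spokeIndex i) (col (spokeIndex j)) - P (lastIndex hm) (col (spokeIndex j))).det ≠ 0)
    (hb : ∀ j : Fin (m - 1), ∑ i, b i *
      (P (spokeIndex i) (col (spokeIndex j)) - P (lastIndex hm) (col (spokeIndex j))) =
        affinePoint hm P' a (col (spokeIndex j)))
    (hder : HasDerivAt (fun r : ℝ => (Matrix.of fun i j =>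
      P i (col j) + r * P' i (col j) - affinePoint hm P a (col j)).det) 0 0) :
    ∑ i, b i * (P (spokeIndex i) (col (lastIndex hm)) - P (lastIndex hm) (col (lastIndex hm))) =
      affinePoint hm P' a (col (lastIndex hm)) := by
  obtain ⟨u, hu⟩ := exists_affineCoeff_ne_zero hm a
  let M : Matrix (Fin m) (Fin m) ℝ := Matrix.of fun i j => P i (col j) - affinePoint hm P a (col j)
  let M' : Matrix (Fin m) (Fin m) ℝ := Matrix.of fun i j => P' i (col j)
  have hc : Matrix.vecMul (affineCoeff a) M = 0 :=
    funext fun j => sum_affineCoeff_mul_sub hm P a (col j)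
  have hy : ∀ j, Matrix.vecMul (affineCoeff a) M' j = affinePoint hm P' a (col j) := fun j =>
    (affinePoint_apply hm P' a (col j)).symm
  have hdet : (M.updateRow u (Matrix.vecMul (affineCoeff a) M')).det = 0 := by
    refine (hasDerivAt_det_of_vecMul_eq_zero M M' hc u).unique ?_
    have := hder.const_mul (affineCoeff a u)
    rw [mul_zero] at this
    have hM : ∀ r : ℝ, M + r • M' =
        Matrix.of fun i j => P i (col j) + r * P' i (col j) - affinePoint hm P a (col j) := by
      intro r
      ext i j
      simp only [M, M', Matrix.add_apply, Matrix.smul_apply, Matrix.of_apply, smul_eq_mul]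
      ring
    simpa only [hM] using this
  -- `β` is a normal covector to the span in the selected coordinates, and the velocity of the
  -- combination is also orthogonal to it. Its last entry is nonzero by `hB`, so a vector orthogonal
  -- to `β` that vanishes in all other coordinates is zero.
  obtain ⟨β, hβ, hMβ⟩ := Matrix.exists_mulVec_eq_zero_iff.2 hdet
  have hyβ : ∑ j, affinePoint hm P' a (col j) * β j = 0 := by
    have := congrFun hMβ u
    simpa [Matrix.mulVec, dotProduct, hy] using this
  have hne : ∀ i, i ≠ u → ∑ j, M i j * β j = 0 := fun i hi => by
    have := congrFun hMβ i
    simpa [Matrix.mulVec, dotProduct, Matrix.updateRow_ne hi] using this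
  have hMi : ∀ i, ∑ j, M i j * β j = 0 := by
    intro i
    by_cases hi : i = u
    · subst hi
      have h1 : Matrix.vecMul (affineCoeff a) M ⬝ᵥ β = 0 := by simp [hc]
      rw [← Matrix.dotProduct_mulVec, dotProduct, Finset.sum_eq_single i] at h1
      · exact (mul_eq_zero.1 h1).resolve_left hu
      · intro k _ hk
        have : M.mulVec β k = 0 := hne k hk
        rw [this, mul_zero]
      · simp
    · exact hne i hi
  have hdiff : ∀ i, ∑ j, (P (spokeIndex i) (col j) - P (lastIndex hm) (col j)) * β j = 0 := by
    intro i
    have := sub_eq_zero_of_eq ((hMi (spokeIndex i)).trans (hMi (lastIndex hm)).symm)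
    rw [← Finset.sum_sub_distrib] at this
    rw [← this]
    refine Finset.sum_congr rfl fun j _ => ?_
    simp only [M, Matrix.of_apply]
    ring
  have hlast : β (lastIndex hm) ≠ 0 := by
    intro h0
    refine hB (Matrix.exists_mulVec_eq_zero_iff.1 ⟨fun j => β (spokeIndex j), fun hz => hβ ?_, ?_⟩)
    · funext j
      rcases eq_lastIndex_or_spokeIndex hm j with rfl | ⟨j, rfl⟩
      · exact h0
      · exact congrFun hz j
    · funext i
      have := hdiff i
      rw [sum_eq_sum_spokeIndex_add hm, h0, mul_zero, add_zero] at this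
      exact this
  have hcomb : ∑ j, (∑ i, b i * (P (spokeIndex i) (col j) - P (lastIndex hm) (col j))
      - affinePoint hm P' a (col j)) * β j = 0 := by
    simp only [sub_mul, Finset.sum_sub_distrib, hyβ, sub_zero, Finset.sum_mul]
    rw [Finset.sum_comm]
    refine Finset.sum_eq_zero fun i _ => ?_
    have := congrArg (b i * ·) (hdiff i)
    simpa only [Finset.mul_sum, mul_zero, mul_assoc, sub_mul] using this
  rw [sum_eq_sum_spokeIndex_add hm, Finset.sum_eq_zero fun j _ => by rw [hb, sub_self, zero_mul],
    zero_add] at hcomb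
  exact sub_eq_zero.1 ((mul_eq_zero.1 hcomb).resolve_right hlast)

namespace WeightedHypergraph

variable {V E : Type*} {n : ℕ}

/-! ### Parametrization of frameworks by vertex positions and affine coefficients -/

section Parametrization

variable (H : WeightedHypergraph V E n)

theorem card_pos (k : E) : 0 < (H.edge k).card := (H.edge_nonempty k).card_pos

/-- The first `|e_k| - 1` coordinates. -/
def coord (k : E) (j : Fin ((H.edge k).card - 1)) : Fin n :=
  ⟨j, by have := H.rank_lt k; omega⟩

theorem column_spokeIndex (k : E) (t : Fin (n + 1 - (H.edge k).card))
    (j : Fin ((H.edge k).card - 1)) : H.column k t (spokeIndex j) = H.coord k j := by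
  have : (j : ℕ) + 1 < (H.edge k).card := by omega
  simp [column, coord, spokeIndex, this]

theorem exists_coord_or_column (k : E) (j : Fin n) :
    (∃ i, j = H.coord k i) ∨ ∃ t, j = H.column k t (lastIndex (H.card_pos k)) := by
  have hpos := H.card_pos k
  have hlt := H.rank_lt k
  by_cases h : (j : ℕ) < (H.edge k).card - 1
  · exact Or.inl ⟨⟨j, h⟩, rfl⟩
  · refine Or.inr ⟨⟨j - ((H.edge k).card - 1), by omega⟩, ?_⟩
    have h' : ¬ (H.edge k).card - 1 + 1 < (H.edge k).card := by omega
    ext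
    simp only [column, lastIndex, h', if_false]
    omega

/-- The index set of the parameters of a framework: the coordinates of the vertices and the affine
coefficients of the pins. -/
abbrev ParamIdx : Type _ :=
  (V × Fin n) ⊕ ((k : E) × (Fin (H.weight k) × Fin ((H.edge k).card - 1)))

/-- The realization with parameters `w`. -/
def paramPos (w : H.ParamIdx → ℝ) : H.Realization := fun v j => w (Sum.inl (v, j))

/-- The affine coefficients of a pin with parameters `w`. -/
def paramCoeff (w : H.ParamIdx → ℝ) (k : E) (l : Fin (H.weight k)) :
    Fin ((H.edge k).card - 1) → ℝ := fun i => w (Sum.inr ⟨k, l, i⟩)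

theorem contDiff_paramPos [Fintype V] [Fintype E] {N : WithTop ℕ∞} :
    ContDiff ℝ N H.paramPos := by
  refine contDiff_pi.2 fun v => contDiff_pi.2 fun j => ?_
  simp only [paramPos]
  fun_prop

theorem isOpen_setOf_isSystem [Fintype E] : IsOpen {x : H.Pins | H.IsSystem x} := by
  have : {x : H.Pins | H.IsSystem x} =
      ⋂ k, {x : H.Pins | LinearIndependent ℝ fun l => homog (x k l)} := by
    ext x
    simp [IsSystem]
  rw [this]
  refine isOpen_iInter_of_finite fun k => ?_
  have hcont : Continuous fun x : H.Pins => fun l => homog (x k l) := by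
    refine continuous_pi fun l => continuous_pi fun j => ?_
    refine Fin.cases ?_ (fun j => ?_) j
    · simp only [homog, Fin.cons_zero]
      fun_prop
    · simp only [homog, Fin.cons_succ]
      fun_prop
  exact isOpen_setOfPred_linearIndependent.preimage hcont

theorem card_paramIdx [Fintype V] [Fintype E] : Fintype.card H.ParamIdx = H.frameworkDim := by
  simp [frameworkDim, mul_comm n]

variable [LinearOrder V]

/-- The points of the hyperedge `e_k`, in increasing order of the vertices. -/
def edgePoints (p : H.Realization) (k : E) (i : Fin (H.edge k).card) : Fin n → ℝ :=
  p ((H.edge k).orderEmbOfFin rfl i)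

/-- The pins with parameters `w`. -/
def paramPins (w : H.ParamIdx → ℝ) : H.Pins := fun k l =>
  affinePoint (H.card_pos k) (H.edgePoints (H.paramPos w) k) (H.paramCoeff w k l)

/-- The parametrization of the space of frameworks. -/
def param (w : H.ParamIdx → ℝ) : H.Pins × H.Realization := (H.paramPins w, H.paramPos w)

theorem pinningSubspace_le_iff (x : H.Pins) (p : H.Realization) (k : E) :
    H.pinningSubspace x k ≤ Submodule.span ℝ ((fun v => homog (p v)) '' (H.edge k : Set V)) ↔
      ∀ l, ∃ a, x k l = affinePoint (H.card_pos k) (H.edgePoints p k) a := by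
  have himage : (fun v => homog (p v)) '' (H.edge k : Set V) =
      Set.range fun i => homog (H.edgePoints p k i) := by
    rw [← Finset.range_orderEmbOfFin (H.edge k) rfl, ← Set.range_comp]
    rfl
  rw [himage, pinningSubspace, Submodule.span_le, Set.range_subset_iff]
  exact forall_congr' fun l => homog_mem_span_iff (H.card_pos k) _ _

theorem isFramework_param_iff (w : H.ParamIdx → ℝ) :
    H.IsFramework (H.paramPins w) (H.paramPos w) ↔ H.IsSystem (H.paramPins w) := by
  refine ⟨fun h => h.1, fun h => ⟨h, fun k => ?_⟩⟩
  rw [pinningSubspace_le_iff]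
  exact fun l => ⟨H.paramCoeff w k l, rfl⟩

theorem exists_param_eq {x : H.Pins} {p : H.Realization} (h : H.IsFramework x p) :
    ∃ w, H.param w = (x, p) := by
  have h2 := fun k => (H.pinningSubspace_le_iff x p k).1 (h.2 k)
  choose a ha using h2
  refine ⟨Sum.elim (fun c => p c.1 c.2) fun r => a r.1 r.2.1 r.2.2, ?_⟩
  refine Prod.ext (funext fun k => funext fun l => ?_) rfl
  exact (ha k l).symm

theorem constraint_eq_zero {x : H.Pins} {p : H.Realization} (h : H.IsFramework x p) (k : E)
    (l : Fin (H.weight k)) (t : Fin (n + 1 - (H.edge k).card)) : H.constraint x k l t p = 0 := by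
  obtain ⟨a, ha⟩ := (H.pinningSubspace_le_iff x p k).1 (h.2 k) l
  rw [constraint, ha]
  exact det_sub_affinePoint (H.card_pos k) (H.edgePoints p k) a (H.column k t)

/-- The matrix of the first `|e_k| - 1` coordinates of the differences between the points of
`e_k` and the last of them. -/
def spokeMatrix (p : H.Realization) (k : E) :
    Matrix (Fin ((H.edge k).card - 1)) (Fin ((H.edge k).card - 1)) ℝ :=
  Matrix.of fun i j => H.edgePoints p k (spokeIndex i) (H.coord k j) -
    H.edgePoints p k (lastIndex (H.card_pos k)) (H.coord k j)

/-- The points of each hyperedge are affinely independent in their first coordinates. -/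
def IsNondegenerate (p : H.Realization) : Prop := ∀ k, (H.spokeMatrix p k).det ≠ 0

/-- The parameters of a nondegenerate framework. -/
noncomputable def coparam (z : H.Pins × H.Realization) : H.ParamIdx → ℝ :=
  Sum.elim (fun c => z.2 c.1 c.2) fun r => ((H.spokeMatrix z.2 r.1).det)⁻¹ *
    Matrix.vecMul (fun j => z.1 r.1 r.2.1 (H.coord r.1 j) -
        H.edgePoints z.2 r.1 (lastIndex (H.card_pos r.1)) (H.coord r.1 j))
      (H.spokeMatrix z.2 r.1).adjugate r.2.2

/-- The first `|e_k| - 1` coordinates of a pin give a square linear system for its affine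
coefficients, which `coparam` solves by Cramer's rule. -/
theorem coparam_param {w : H.ParamIdx → ℝ} (hw : H.IsNondegenerate (H.paramPos w)) :
    H.coparam (H.param w) = w := by
  funext r
  rcases r with ⟨v, j⟩ | ⟨k, l, i⟩
  · rfl
  · have hvec : (fun j => H.paramPins w k l (H.coord k j) -
        H.edgePoints (H.paramPos w) k (lastIndex (H.card_pos k)) (H.coord k j)) =
        Matrix.vecMul (H.paramCoeff w k l) (H.spokeMatrix (H.paramPos w) k) := by
      funext j
      simp only [paramPins, affinePoint, add_sub_cancel_left]
      rfl
    simp only [coparam, param, Sum.elim_inr, hvec]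
    rw [Matrix.vecMul_vecMul, Matrix.mul_adjugate, Matrix.vecMul_smul, Matrix.vecMul_one,
      Pi.smul_apply, smul_eq_mul, inv_mul_cancel_left₀ (hw k)]
    rfl

theorem continuous_spokeMatrix (k : E) : Continuous fun p => H.spokeMatrix p k := by
  refine continuous_matrix fun i j => ?_
  simp only [spokeMatrix, edgePoints, Matrix.of_apply]
  fun_prop

theorem continuousAt_coparam {z : H.Pins × H.Realization} (hz : H.IsNondegenerate z.2) :
    ContinuousAt H.coparam z := by
  refine continuousAt_pi.2 fun r => ?_
  rcases r with ⟨v, j⟩ | ⟨k, l, i⟩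
  · simp only [coparam, Sum.elim_inl]
    fun_prop
  · simp only [coparam, Sum.elim_inr]
    have hS : Continuous fun z : H.Pins × H.Realization => H.spokeMatrix z.2 k :=
      (H.continuous_spokeMatrix k).comp continuous_snd
    refine (hS.matrix_det.continuousAt.inv₀ (hz k)).mul (Continuous.continuousAt ?_)
    have hv : Continuous fun z : H.Pins × H.Realization => fun j => z.1 k l (H.coord k j) -
        H.edgePoints z.2 k (lastIndex (H.card_pos k)) (H.coord k j) := by
      simp only [edgePoints]
      fun_prop
    exact (continuous_apply i).comp (hv.matrix_vecMul hS.matrix_adjugate)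

theorem contDiff_paramPins [Fintype V] [Fintype E] {N : WithTop ℕ∞} :
    ContDiff ℝ N H.paramPins := by
  refine contDiff_pi.2 fun k => contDiff_pi.2 fun l => contDiff_pi.2 fun j => ?_
  simp only [paramPins, affinePoint, edgePoints, paramCoeff, paramPos]
  fun_prop

theorem contDiff_param [Fintype V] [Fintype E] {N : WithTop ℕ∞} : ContDiff ℝ N H.param :=
  H.contDiff_paramPins.prodMk H.contDiff_paramPos

theorem isOpen_setOf_isNondegenerate [Fintype E] :
    IsOpen {p : H.Realization | H.IsNondegenerate p} := by
  have : {p : H.Realization | H.IsNondegenerate p} =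
      ⋂ k, {p : H.Realization | (H.spokeMatrix p k).det ≠ 0} := by
    ext p
    simp [IsNondegenerate]
  rw [this]
  exact isOpen_iInter_of_finite fun k =>
    isOpen_ne_fun (H.continuous_spokeMatrix k).matrix_det continuous_const

theorem exists_det_spokeMatrix_ne_zero (k : E) :
    ∃ w, (H.spokeMatrix (H.paramPos w) k).det ≠ 0 := by
  classical
  let ε := (H.edge k).orderEmbOfFin rfl
  -- The last vertex of the hyperedge is placed at the origin and the others at distinct unit
  -- vectors, which makes the spoke matrix the identity.
  refine ⟨Sum.elim (fun c => if ∃ i, ε (spokeIndex i) = c.1 ∧ H.coord k i = c.2 then 1 else 0)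
    fun _ => 0, ?_⟩
  have hcoord : Function.Injective (H.coord k) := fun i j h => Fin.ext (Fin.mk.inj h)
  have hmat : H.spokeMatrix (H.paramPos (Sum.elim
      (fun c => if ∃ i, ε (spokeIndex i) = c.1 ∧ H.coord k i = c.2 then 1 else 0)
      fun _ => 0)) k = 1 := by
    ext i j
    have h1 : (∃ i', ε (spokeIndex i') = ε (spokeIndex i) ∧ H.coord k i' = H.coord k j) ↔
        i = j := by
      constructor
      · rintro ⟨i', h, h'⟩
        rw [← spokeIndex_injective (ε.injective h), hcoord h']
      · rintro rfl
        exact ⟨i, rfl, rfl⟩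
    have h2 : ¬ ∃ i', ε (spokeIndex i') = ε (lastIndex (H.card_pos k)) ∧
        H.coord k i' = H.coord k j := by
      rintro ⟨i', h, -⟩
      exact spokeIndex_ne_lastIndex _ _ (ε.injective h)
    simp only [spokeMatrix, edgePoints, paramPos, Matrix.of_apply, Sum.elim_inl, Matrix.one_apply]
    change (if ∃ i', ε (spokeIndex i') = ε (spokeIndex i) ∧ H.coord k i' = H.coord k j
      then (1 : ℝ) else 0) - (if ∃ i', ε (spokeIndex i') = ε (lastIndex (H.card_pos k)) ∧
        H.coord k i' = H.coord k j then (1 : ℝ) else 0) = _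
    rw [if_neg h2, sub_zero]
    simp only [h1]
  simp [hmat]

theorem volume_setOf_not_isNondegenerate [Fintype V] [Fintype E] :
    volume {w | ¬ H.IsNondegenerate (H.paramPos w)} = 0 := by
  have : {w | ¬ H.IsNondegenerate (H.paramPos w)} =
      ⋃ k, {w | (H.spokeMatrix (H.paramPos w) k).det = 0} := by
    ext w
    simp [IsNondegenerate]
  rw [this, measure_iUnion_null_iff]
  intro k
  obtain ⟨w, hw⟩ := H.exists_det_spokeMatrix_ne_zero k
  refine measure_zeros_eq_zero_of_contDiff_omega volume (ContDiff.matrix_det fun i j => ?_) hw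
  simp only [spokeMatrix, edgePoints, paramPos, Matrix.of_apply]
  fun_prop

end Parametrization

end WeightedHypergraph

namespace WeightedHypergraph

/-! ### Rigidity, infinitesimal rigidity and the rank of the map to the pins -/

section Rigidity

variable {V E : Type*} {n : ℕ} [LinearOrder V] [Fintype V] (H : WeightedHypergraph V E n)

theorem contDiff_constraint (x : H.Pins) (k : E) (l : Fin (H.weight k))
    (t : Fin (n + 1 - (H.edge k).card)) {N : WithTop ℕ∞} :
    ContDiff ℝ N (H.constraint x k l t) := by
  refine ContDiff.matrix_det fun i j => ?_
  simp only [Matrix.of_apply]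
  fun_prop

theorem rigidityMatrix_mulVec (x : H.Pins) (p p' : H.Realization) (r : H.Row) :
    (H.rigidityMatrix x p).mulVec (fun c => p' c.1 c.2) r =
      fderiv ℝ (H.constraint x r.1 r.2.1 r.2.2) p p' := by
  have hp' : p' = ∑ c : V × Fin n, p' c.1 c.2 • Pi.single c.1 (Pi.single c.2 (1 : ℝ)) := by
    funext v j
    simp only [Finset.sum_apply, Pi.smul_apply]
    rw [Finset.sum_eq_single (v, j)]
    · simp
    · rintro ⟨v', j'⟩ - hne
      by_cases hv : v = v'
      · subst hv
        have hj : j ≠ j' := fun h => hne (by rw [h])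
        simp [hj]
      · simp [hv]
    · simp
  conv_rhs => rw [hp', map_sum]
  simp only [map_smul, smul_eq_mul]
  exact Finset.sum_congr rfl fun c _ => mul_comm _ _

/-- A framework is infinitesimally rigid if and only if it has no nonzero infinitesimal motion. -/
theorem isInfinitesimallyRigid_iff [Fintype E] (x : H.Pins) (p : H.Realization) :
    H.IsInfinitesimallyRigid x p ↔
      ∀ p' : H.Realization,
        (∀ r : H.Row, fderiv ℝ (H.constraint x r.1 r.2.1 r.2.2) p p' = 0) → p' = 0 := by
  have hsum := (H.rigidityMatrix x p).mulVecLin.finrank_range_add_finrank_ker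
  rw [Module.finrank_fintype_fun_eq_card, Fintype.card_prod, Fintype.card_fin, mul_comm] at hsum
  have hker : H.IsInfinitesimallyRigid x p ↔ (H.rigidityMatrix x p).mulVecLin.ker = ⊥ := by
    rw [IsInfinitesimallyRigid, Matrix.rank, ← Submodule.finrank_eq_zero (R := ℝ)]
    omega
  rw [hker, LinearMap.ker_eq_bot']
  constructor
  · intro h p' hp'
    have := h (fun c => p' c.1 c.2) (funext fun r => by
      rw [Matrix.mulVecLin_apply, rigidityMatrix_mulVec, hp' r, Pi.zero_apply])
    exact funext fun v => funext fun j => congrFun this (v, j)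
  · intro h c hc
    have := h (fun v j => c (v, j)) fun r => by
      rw [← rigidityMatrix_mulVec]
      exact congrFun hc r
    exact funext fun c' => congrFun (congrFun this c'.1) c'.2

/-- An injective derivative separates `p` from nearby points by the values of the constraints, which
vanish at every realization. No converse, from vanishing constraints to incidence, is needed. -/
theorem IsInfinitesimallyRigid.isRigid [Fintype E] {x : H.Pins} {p : H.Realization}
    (hx : H.IsFramework x p) (h : H.IsInfinitesimallyRigid x p) : H.IsRigid x p := by
  rw [isInfinitesimallyRigid_iff] at h
  let F : H.Realization → H.Row → ℝ := fun q r => H.constraint x r.1 r.2.1 r.2.2 q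
  let F' : H.Realization →L[ℝ] H.Row → ℝ :=
    ContinuousLinearMap.pi fun r => fderiv ℝ (H.constraint x r.1 r.2.1 r.2.2) p
  have hF : HasFDerivAt F F' p := hasFDerivAt_pi.2 fun r =>
    ((H.contDiff_constraint x r.1 r.2.1 r.2.2).differentiable one_ne_zero p).hasFDerivAt
  obtain ⟨K, -, hK⟩ := LinearMap.exists_antilipschitzWith (F' : H.Realization →ₗ[ℝ] H.Row → ℝ)
    (LinearMap.ker_eq_bot'.2 fun p' hp' => h p' fun r => congrFun hp' r)
  have hne : ∀ᶠ q in 𝓝[≠] p, F q ≠ F p :=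
    hF.eventually_ne ⟨K, hK⟩
  rw [eventually_nhdsWithin_iff] at hne
  refine ⟨_, hne, fun q hq hfr => ?_⟩
  by_contra hqp
  exact hq hqp (funext fun r =>
    (H.constraint_eq_zero hfr r.1 r.2.1 r.2.2).trans (H.constraint_eq_zero hx r.1 r.2.1 r.2.2).symm)

/-- An infinitesimal motion of a nondegenerate framework extends to an infinitesimal change of the
parameters that fixes the pins. -/
theorem derivNullity_paramPins_pos [Fintype E] {w : H.ParamIdx → ℝ}
    (hw : H.IsNondegenerate (H.paramPos w))
    (h : ¬ H.IsInfinitesimallyRigid (H.paramPins w) (H.paramPos w)) :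
    0 < derivNullity H.paramPins w := by
  rw [isInfinitesimallyRigid_iff] at h
  push Not at h
  obtain ⟨p', hp', hne⟩ := h
  -- The right side is the velocity of the pin when the vertices move by `p'` and the coefficients
  -- stay fixed. The spoke matrix determines `b` from the first coordinates; each remaining
  -- coordinate is matched by one differentiated constraint.
  have hcoeff : ∀ k l, ∃ b : Fin ((H.edge k).card - 1) → ℝ, ∀ j,
      ∑ i, b i * (H.edgePoints (H.paramPos w) k (spokeIndex i) j -
        H.edgePoints (H.paramPos w) k (lastIndex (H.card_pos k)) j) =
      affinePoint (H.card_pos k) (H.edgePoints p' k) (H.paramCoeff w k l) j := by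
    intro k l
    have hu : IsUnit (H.spokeMatrix (H.paramPos w) k).det := isUnit_iff_ne_zero.2 (hw k)
    let y := affinePoint (H.card_pos k) (H.edgePoints p' k) (H.paramCoeff w k l)
    let b := Matrix.vecMul (fun j => y (H.coord k j)) (H.spokeMatrix (H.paramPos w) k)⁻¹
    have hb : ∀ j, ∑ i, b i * (H.edgePoints (H.paramPos w) k (spokeIndex i) (H.coord k j) -
        H.edgePoints (H.paramPos w) k (lastIndex (H.card_pos k)) (H.coord k j)) =
        y (H.coord k j) := by
      intro j
      have : Matrix.vecMul b (H.spokeMatrix (H.paramPos w) k) = fun j => y (H.coord k j) := by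
        simp only [b]
        rw [Matrix.vecMul_vecMul, Matrix.nonsing_inv_mul _ hu, Matrix.vecMul_one]
      exact congrFun this j
    refine ⟨b, fun j => ?_⟩
    rcases H.exists_coord_or_column k j with ⟨i, rfl⟩ | ⟨t, rfl⟩
    · exact hb i
    · refine sum_mul_sub_eq_affinePoint_of_hasDerivAt_det (H.card_pos k) ?_ ?_ ?_
      · simp only [column_spokeIndex]
        exact hw k
      · simp only [column_spokeIndex]
        exact hb
      · have hd := ((H.contDiff_constraint (H.paramPins w) k l t).differentiable one_ne_zero
          (H.paramPos w)).hasFDerivAt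
        have hline : HasDerivAt (fun r : ℝ => H.paramPos w + r • p') p' 0 := by
          simpa using ((hasDerivAt_id (0 : ℝ)).smul_const p').const_add (H.paramPos w)
        have hd' := HasFDerivAt.comp_hasDerivAt_of_eq 0 hd hline (by simp)
        rw [hp' ⟨k, l, t⟩] at hd'
        exact hd'
  choose b hb using hcoeff
  -- The sign makes the change of coefficients cancel the velocity of the pin.
  let w' : H.ParamIdx → ℝ := Sum.elim (fun c => p' c.1 c.2) fun r => - b r.1 r.2.1 r.2.2
  have hw' : w' ≠ 0 := fun h0 => hne (funext fun v => funext fun j => congrFun h0 (Sum.inl (v, j)))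
  have hfd : fderiv ℝ H.paramPins w w' = 0 := by
    have hd := ((H.contDiff_paramPins.differentiable one_ne_zero) w).hasFDerivAt
    have hline : HasDerivAt (fun r : ℝ => w + r • w') w' 0 := by
      simpa using ((hasDerivAt_id (0 : ℝ)).smul_const w').const_add w
    have hd' := HasFDerivAt.comp_hasDerivAt_of_eq 0 hd hline (by simp)
    refine hd'.unique ?_
    refine hasDerivAt_pi.2 fun k => hasDerivAt_pi.2 fun l => hasDerivAt_pi.2 fun j => ?_
    let P := H.edgePoints (H.paramPos w) k
    let P' := H.edgePoints p' k
    let a := H.paramCoeff w k l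
    let L := lastIndex (H.card_pos k)
    have hlin : ∀ c c' : ℝ, HasDerivAt (fun r : ℝ => c + r * c') c' 0 := fun c c' => by
      simpa using ((hasDerivAt_id (0 : ℝ)).mul_const c').const_add c
    have hexp : HasDerivAt (fun r : ℝ => (P L j + r * P' L j) +
        ∑ i, (a i + r * (- b k l i)) *
          ((P (spokeIndex i) j + r * P' (spokeIndex i) j) - (P L j + r * P' L j)))
        (P' L j + ∑ i, ((- b k l i) * ((P (spokeIndex i) j + 0 * P' (spokeIndex i) j) -
          (P L j + 0 * P' L j)) + (a i + 0 * (- b k l i)) * (P' (spokeIndex i) j - P' L j))) 0 :=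
      (hlin _ _).fun_add (HasDerivAt.fun_sum fun i _ =>
        (hlin _ _).fun_mul ((hlin _ _).fun_sub (hlin _ _)))
    have hzero : P' L j + ∑ i, ((- b k l i) * ((P (spokeIndex i) j + 0 * P' (spokeIndex i) j) -
        (P L j + 0 * P' L j)) + (a i + 0 * (- b k l i)) * (P' (spokeIndex i) j - P' L j)) = 0 := by
      have h1 := hb k l j
      simp only [zero_mul, add_zero, neg_mul, Finset.sum_add_distrib, Finset.sum_neg_distrib]
      rw [h1, affinePoint]
      ring
    rw [hzero] at hexp
    exact hexp
  refine Module.finrank_pos_iff.2 ⟨⟨⟨w', hfd⟩, 0, fun h0 => hw' (congrArg Subtype.val h0)⟩⟩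

/-- The parameters at which the framework is nondegenerate and the map to the pins has maximal
rank. -/
def regularParams [Fintype E] : Set (H.ParamIdx → ℝ) :=
  {w | H.IsNondegenerate (H.paramPos w) ∧
    ∀ w', derivNullity H.paramPins w ≤ derivNullity H.paramPins w'}

theorem isOpen_regularParams [Fintype E] : IsOpen H.regularParams :=
  (H.isOpen_setOf_isNondegenerate.preimage (H.contDiff_paramPos (N := 0)).continuous).inter
    (isOpen_setOf_derivNullity_le H.contDiff_paramPins)

theorem volume_compl_regularParams [Fintype E] : volume H.regularParamsᶜ = 0 := by
  refine measure_mono_null (fun w hw => ?_) (measure_union_null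
    H.volume_setOf_not_isNondegenerate
    (volume_setOf_not_derivNullity_le (H.contDiff_paramPins (N := ω))))
  exact not_and_or.1 hw

theorem dense_regularParams [Fintype E] : Dense H.regularParams :=
  Measure.dense_of_ae (μ := volume) (mem_ae_iff.2 H.volume_compl_regularParams)

/-- At regular parameters at which the map to the pins is not immersive, the framework is not
rigid. -/
theorem not_isRigid_of_derivNullity_pos [Fintype E] {w : H.ParamIdx → ℝ}
    (hw : w ∈ H.regularParams) (hsys : H.IsSystem (H.paramPins w))
    (hpos : 0 < derivNullity H.paramPins w) : ¬ H.IsRigid (H.paramPins w) (H.paramPos w) := by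
  rintro ⟨N, hN, hrigid⟩
  have hfreq := frequently_eq_of_derivNullity_le (H.contDiff_paramPins (N := 1)) hpos
    (Eventually.of_forall hw.2)
  have hreg : ∀ᶠ w' in 𝓝[≠] w, w' ∈ H.regularParams :=
    nhdsWithin_le_nhds (H.isOpen_regularParams.mem_nhds hw)
  have hmem : ∀ᶠ w' in 𝓝[≠] w, H.paramPos w' ∈ N :=
    nhdsWithin_le_nhds ((H.contDiff_paramPos (N := 0)).continuous.continuousAt hN)
  obtain ⟨w', heq, hreg', hmem', hne⟩ :=
    (hfreq.and_eventually (hreg.and (hmem.and self_mem_nhdsWithin))).exists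
  have hfr : H.IsFramework (H.paramPins w) (H.paramPos w') := by
    rw [← heq]
    exact (H.isFramework_param_iff w').2 (heq ▸ hsys)
  have hpp := hrigid _ hmem' hfr
  -- Equal pins and equal positions would force equal parameters, by nondegeneracy.
  refine hne ?_
  rw [Set.mem_singleton_iff, ← H.coparam_param hreg'.1, ← H.coparam_param hw.1, param, param,
    heq, hpp]

/-- At regular parameters, rigidity and infinitesimal rigidity both hold or both fail, according to
whether the generic rank of the map to the pins is full. -/
theorem isRigid_iff_of_mem_regularParams [Fintype E] {w : H.ParamIdx → ℝ}
    (hw : w ∈ H.regularParams) (hsys : H.IsSystem (H.paramPins w)) :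
    (H.IsInfinitesimallyRigid (H.paramPins w) (H.paramPos w) ↔
      ∃ w', derivNullity H.paramPins w' = 0) ∧
    (H.IsRigid (H.paramPins w) (H.paramPos w) ↔ ∃ w', derivNullity H.paramPins w' = 0) := by
  have h1 : H.IsInfinitesimallyRigid (H.paramPins w) (H.paramPos w) →
      H.IsRigid (H.paramPins w) (H.paramPos w) :=
    IsInfinitesimallyRigid.isRigid H ((H.isFramework_param_iff w).2 hsys)
  have h2 : H.IsRigid (H.paramPins w) (H.paramPos w) →
      ∃ w', derivNullity H.paramPins w' = 0 := fun h => ⟨w, by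
    by_contra h0
    exact H.not_isRigid_of_derivNullity_pos hw hsys (Nat.pos_of_ne_zero h0) h⟩
  have h3 : (∃ w', derivNullity H.paramPins w' = 0) →
      H.IsInfinitesimallyRigid (H.paramPins w) (H.paramPos w) := by
    rintro ⟨w', hw'⟩
    by_contra h
    have := H.derivNullity_paramPins_pos hw.1 h
    have := hw.2 w'
    omega
  exact ⟨⟨fun h => h2 (h1 h), h3⟩, ⟨h2, fun h => h1 (h3 h)⟩⟩

/-- Continuity of `coparam` makes every framework near a regular one again regular, and on regular
frameworks both properties obey a criterion independent of the framework. -/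
theorem isGenericFramework_of_mem_regularParams [Fintype E] {w : H.ParamIdx → ℝ}
    (hw : w ∈ H.regularParams) (hsys : H.IsSystem (H.paramPins w)) :
    H.IsGenericFramework (H.paramPins w) (H.paramPos w) := by
  have hcont : ContinuousAt H.coparam (H.param w) := H.continuousAt_coparam hw.1
  have hN : {z : H.Pins × H.Realization | H.IsNondegenerate z.2 ∧
      H.coparam z ∈ H.regularParams} ∈ 𝓝 (H.param w) := by
    have h1 : ∀ᶠ z : H.Pins × H.Realization in 𝓝 (H.param w), H.IsNondegenerate z.2 :=
      (H.isOpen_setOf_isNondegenerate.preimage continuous_snd).mem_nhds hw.1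
    have h2 : ∀ᶠ z in 𝓝 (H.param w), H.coparam z ∈ H.regularParams := by
      refine hcont.eventually_mem ?_
      rw [H.coparam_param hw.1]
      exact H.isOpen_regularParams.mem_nhds hw
    exact h1.and h2
  have hreg : ∀ z : H.Pins × H.Realization, H.IsNondegenerate z.2 ∧
      H.coparam z ∈ H.regularParams → H.IsFramework z.1 z.2 →
      ∃ w' ∈ H.regularParams, H.param w' = z := by
    rintro ⟨x, p⟩ ⟨hz, hz'⟩ hfr
    obtain ⟨w', hw'⟩ := H.exists_param_eq hfr
    obtain ⟨rfl, rfl⟩ := Prod.mk.inj hw'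
    exact ⟨w', H.coparam_param hz ▸ hz', rfl⟩
  refine ⟨(H.isFramework_param_iff w).2 hsys, ⟨_, hN, fun z hz hfr => ?_⟩,
    ⟨_, hN, fun z hz hfr => ?_⟩⟩
  · obtain ⟨w', hw', rfl⟩ := hreg z hz hfr
    exact (H.isRigid_iff_of_mem_regularParams hw' hfr.1).2.trans
      (H.isRigid_iff_of_mem_regularParams hw hsys).2.symm
  · obtain ⟨w', hw', rfl⟩ := hreg z hz hfr
    exact (H.isRigid_iff_of_mem_regularParams hw' hfr.1).1.trans
      (H.isRigid_iff_of_mem_regularParams hw hsys).1.symm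

/-- For a generic framework, rigidity and infinitesimal rigidity both hold or both fail, according
to whether the generic rank of the map to the pins is full. -/
theorem IsGenericFramework.isRigid_iff [Fintype E] {x : H.Pins} {p : H.Realization}
    (h : H.IsGenericFramework x p) :
    (H.IsInfinitesimallyRigid x p ↔ ∃ w, derivNullity H.paramPins w = 0) ∧
    (H.IsRigid x p ↔ ∃ w, derivNullity H.paramPins w = 0) := by
  obtain ⟨hfr, ⟨N₁, hN₁, h₁⟩, N₂, hN₂, h₂⟩ := h
  obtain ⟨w, hw⟩ := H.exists_param_eq hfr
  have hcont : Tendsto H.param (𝓝 w) (𝓝 (x, p)) :=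
    hw ▸ (H.contDiff_param (N := 0)).continuous.tendsto w
  have hsys : ∀ᶠ z : H.Pins × H.Realization in 𝓝 (x, p), H.IsSystem z.1 :=
    (H.isOpen_setOf_isSystem.preimage continuous_fst).mem_nhds hfr.1
  have hev : ∀ᶠ w' in 𝓝 w, H.param w' ∈ N₁ ∧ H.param w' ∈ N₂ ∧ H.IsSystem (H.paramPins w') :=
    (hcont.eventually_mem hN₁).and ((hcont.eventually_mem hN₂).and (hcont.eventually hsys))
  -- A generic framework need not have regular parameters itself, but it agrees on both properties
  -- with a regular framework nearby.
  obtain ⟨w', ⟨hw₁, hw₂, hs⟩, hreg⟩ := mem_closure_iff_nhds.1 (H.dense_regularParams w) _ hev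
  have hfr' := (H.isFramework_param_iff w').2 hs
  have hiff := H.isRigid_iff_of_mem_regularParams hreg hs
  exact ⟨(h₂ _ hw₂ hfr').symm.trans hiff.1, (h₁ _ hw₁ hfr').symm.trans hiff.2⟩

end Rigidity

end WeightedHypergraph

/-! ### The main theorem -/

theorem mainTheorem2 {V E : Type*} [Fintype V] [LinearOrder V] [Fintype E] {n : ℕ}
    (H : WeightedHypergraph V E n) :
    (∀ (x : H.Pins) (p : H.Realization), H.IsGenericFramework x p →
      (H.IsInfinitesimallyRigid x p ↔ H.IsRigid x p) ∧
      (H.IsInfinitesimallyRigid x p ↔ H.IsGenericallyRigid x)) ∧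
    Measure.hausdorffMeasure (H.frameworkDim : ℝ)
      {z : H.Pins × H.Realization |
        H.IsFramework z.1 z.2 ∧ ¬ H.IsGenericFramework z.1 z.2} = 0 := by
  refine ⟨fun x p h => ?_, ?_⟩
  · have hx := h.isRigid_iff
    refine ⟨hx.1.trans hx.2.symm, fun hi => ⟨p, h, hx.2.2 (hx.1.1 hi)⟩, ?_⟩
    -- The witness `p'` may differ from `p`; the criterion transfers because it involves neither of
    -- them.
    rintro ⟨p', hgen, hrigid⟩
    exact hx.1.2 (hgen.isRigid_iff.2.1 hrigid)
  · have himage := hausdorffMeasure_image_eq_zero_of_contDiff (H.contDiff_param (N := 1))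
      H.volume_compl_regularParams
    rw [H.card_paramIdx] at himage
    refine measure_mono_null ?_ himage
    rintro ⟨x, p⟩ ⟨hfr, hgen⟩
    obtain ⟨w, hw⟩ := H.exists_param_eq hfr
    obtain ⟨rfl, rfl⟩ := Prod.mk.inj hw
    exact ⟨w, fun hreg => hgen (H.isGenericFramework_of_mem_regularParams hreg hfr.1), hw⟩
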